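/- **Conventions.** All algebras are nonempty. A variety is the class of all algebras of a fixed (finitary) signature that satisfy a given set of identities. For an algebra $\mathbf A$ with set of congruences $\mathrm{Con}(\mathbf A)$, $\Delta_{\mathbf A}$ denotes the least congruence. $\mathbf A$ is *finitely subdirectly irreducible* if whenever $\Delta_{\mathbf A}$ is the intersection of a nonempty finite family $\{\Theta_i\}_{i\in I}$ of congruences of $\mathbf A$, then $\Delta_{\mathbf A}=\Theta_i$ for some $i\in I$ (so trivial algebras are finitely subdirectly irreducible); $\mathbf K_{\mathrm{FSI}}$ denotes the class of finitely subdirectly irreducible members of a class $\mathbf K$. A variety $\mathbf V$ has the *congruence extension property* if for all $\mathbf B\in\mathbf V$ and all subalgebras $\mathbf A\le\mathbf B$, every congruence of $\mathbf A$ is the restriction to $A$ of a congruence of $\mathbf B$. $\mathbb H(\mathbf K)$ and $\mathbb S(\mathbf K)$ are the classes of homomorphic images, respectively (isomorphic copies of) subalgebras, of members of $\mathbf K$. A *span* in a class $\mathbf K$ is a pair of injective homomorphisms $\langle i_1\colon\mathbf A\to\mathbf B,\ i_2\colon\mathbf A\to\mathbf C\rangle$ with $\mathbf A,\mathbf B,\mathbf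 C\in\mathbf K$; an *amalgam* of it in $\mathbf K$ is a pair of injective homomorphisms $\langle j_1\colon\mathbf B\to\mathbf D,\ j_2\colon\mathbf C\to\mathbf D\rangle$ with $\mathbf D\in\mathbf K$ and $j_1\circ i_1=j_2\circ i_2$. $\mathbf K$ has the *amalgamation property* if every span in $\mathbf K$ has an amalgam in $\mathbf K$. An embedding $\varphi\colon\mathbf A\to\mathbf B$ is *essential* if for every $\theta\in\mathrm{Con}(\mathbf B)$ with $\theta\ne\Delta_{\mathbf B}$, the restriction of $\theta$ to the subalgebra $\varphi[\mathbf A]$ is not $\Delta_{\varphi[\mathbf A]}$. $\mathbf K$ has the *essential amalgamation property* if every span $\langle i_1,i_2\rangle$ in $\mathbf K$ for which $i_2$ is essential has an amalgam in $\mathbf K$. A *commutative residuated lattice* is an algebra $\langle A,\wedge,\vee,\cdot,\to,1\rangle$ such that $\langle A,\wedge,\vee\rangle$ is a lattice, $\langle A,\cdot,1\rangle$ is a commutative monoid, and $x\cdot y\le z\iff x\le y\to z$ for all $x,y,z\in A$, where $x\le y$ means $x\wedge y=x$. A *pointed* one has in addition one arbitrary constant in its signature. A variety of commutative (pointed) residuated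 lattices is *semilinear* if it is generated, as a variety, by its totally ordered members. **Theorem.** 1. Let $\mathbf V$ be a variety (of any finitary signature) with the congruence extension property such that $\mathbb{HS}(\mathbf V_{\mathrm{FSI}})=\mathbf V_{\mathrm{FSI}}$. Then $\mathbf V$ has the amalgamation property if and only if $\mathbf V_{\mathrm{FSI}}$ has the essential amalgamation property. 2. Let $\mathbf V$ be a semilinear variety of commutative residuated lattices, or a semilinear variety of commutative pointed residuated lattices. Then $\mathbf V$ has the amalgamation property if and only if $\mathbf V_{\mathrm{FSI}}$ has the essential amalgamation property. -/

import Mathlib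

open FirstOrder FirstOrder.Language CategoryTheory

universe u v w

namespace UA

section General

/-! Signatures are first-order languages without relation symbols; an algebra is a structure with
nonempty carrier, and a class of algebras is a set of bundled structures.  An embedding `A ↪[L] B`
is then the same thing as an injective homomorphism. -/

variable {L : FirstOrder.Language.{u, v}}

/-- `θ` is a congruence of the algebra `A`. -/
def IsCongruence {A : Type w} [L.Structure A] (θ : Setoid A) : Prop :=
  ∀ (n : ℕ) (f : L.Functions n) (x y : Fin n → A),
    (∀ i, θ (x i) (y i)) → θ (Structure.funMap f x) (Structure.funMap f y)

/-- `A ⊨ s ≈ t`. -/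
def Satisfies (A : Type w) [L.Structure A] (e : L.Term ℕ × L.Term ℕ) : Prop :=
  ∀ x : ℕ → A, e.1.realize x = e.2.realize x

/-- A variety: the class of all (nonempty) algebras that satisfy some set of identities. -/
def IsVariety (V : Set (Bundled.{w} L.Structure)) : Prop :=
  ∃ E : Set (L.Term ℕ × L.Term ℕ),
    V = {A : Bundled.{w} L.Structure | Nonempty A ∧ ∀ e ∈ E, Satisfies (L := L) A e}

/-- The variety generated by `K`: the least variety that contains `K`. -/
def generatedVariety (K : Set (Bundled.{w} L.Structure)) : Set (Bundled.{w} L.Structure) :=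
  ⋂₀ {W | IsVariety W ∧ K ⊆ W}

/-- All homomorphic images of members of `K`. -/
def homImages (K : Set (Bundled.{w} L.Structure)) : Set (Bundled.{w} L.Structure) :=
  {B | ∃ A ∈ K, ∃ f : A →[L] B, Function.Surjective f}

/-- All subalgebras (with nonempty carrier, and up to isomorphism) of members of `K`. -/
def subalgebras (K : Set (Bundled.{w} L.Structure)) : Set (Bundled.{w} L.Structure) :=
  {B | Nonempty B ∧ ∃ A ∈ K, Nonempty (B ↪[L] A)}

/-- `A` is finitely subdirectly irreducible: whenever the least congruence is the intersection of
a nonempty finite family of congruences, it belongs to the family.  (Trivial algebras are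
finitely subdirectly irreducible.) -/
def IsFSI (L : FirstOrder.Language.{u, v}) (A : Type w) [L.Structure A] : Prop :=
  ∀ S : Set (Setoid A), S.Finite → S.Nonempty → (∀ θ ∈ S, IsCongruence (L := L) θ) →
    sInf S = ⊥ → ⊥ ∈ S

/-- The class of finitely subdirectly irreducible members of `K`. -/
def fsi (K : Set (Bundled.{w} L.Structure)) : Set (Bundled.{w} L.Structure) :=
  {A ∈ K | IsFSI L A}

/-- The congruence extension property: every congruence of a subalgebra of a member of `K` is the
restriction of a congruence of that member. -/
def CongruenceExtensionProperty (K : Set (Bundled.{w} L.Structure)) : Prop :=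
  ∀ B ∈ K, ∀ (A : L.Substructure B) (θ : Setoid A), IsCongruence (L := L) θ →
    ∃ ψ : Setoid B, IsCongruence (L := L) ψ ∧ ψ.comap (Subtype.val : A → B) = θ

/-- The extension `A ≤ B` is essential: a congruence of `B` other than the least one restricts to
a congruence of `A` other than the least one. -/
def IsEssentialExtension {B : Type w} [L.Structure B] (A : L.Substructure B) : Prop :=
  ∀ θ : Setoid B, IsCongruence (L := L) θ → θ ≠ ⊥ → θ.comap (Subtype.val : A → B) ≠ ⊥

/-- An embedding is essential if its target is an essential extension of its image. -/
def IsEssentialEmbedding {A B : Type w} [L.Structure A] [L.Structure B] (φ : A ↪[L] B) : Prop :=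
  IsEssentialExtension φ.toHom.range

/-- The essential amalgamation property: every span in `K` whose second map is an essential
embedding has an amalgam in `K`.  (Without the essentiality assumption this is
`FirstOrder.Language.Amalgamation`.) -/
def EssentialAmalgamation (K : Set (Bundled.{w} L.Structure)) : Prop :=
  ∀ (A B C : Bundled.{w} L.Structure) (i₁ : A ↪[L] B) (i₂ : A ↪[L] C),
    A ∈ K → B ∈ K → C ∈ K → IsEssentialEmbedding i₂ →
      ∃ (D : Bundled.{w} L.Structure) (j₁ : B ↪[L] D) (j₂ : C ↪[L] D),
        D ∈ K ∧ j₁.comp i₁ = j₂.comp i₂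

end General

section ResiduatedLattices

/-- The operation symbols `∧, ∨, ·, →, 1` of residuated lattices, and, in the pointed case, one
further constant symbol. -/
inductive RLSymbol (pointed : Bool) : ℕ → Type
  | inf : RLSymbol pointed 2
  | sup : RLSymbol pointed 2
  | mul : RLSymbol pointed 2
  | imp : RLSymbol pointed 2
  | one : RLSymbol pointed 0
  | point : pointed = true → RLSymbol pointed 0

/-- The signature of (pointed) residuated lattices. -/
def rlLanguage (pointed : Bool) : FirstOrder.Language.{0, 0} := ⟨RLSymbol pointed, fun _ => Empty⟩

variable (pointed : Bool) {A : Type w} [(rlLanguage pointed).Structure A]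

/-- The meet of `x` and `y`. -/
def rlInf (x y : A) : A :=
  Structure.funMap (L := rlLanguage pointed) (RLSymbol.inf : RLSymbol pointed 2) ![x, y]

/-- The join of `x` and `y`. -/
def rlSup (x y : A) : A :=
  Structure.funMap (L := rlLanguage pointed) (RLSymbol.sup : RLSymbol pointed 2) ![x, y]

/-- The product of `x` and `y`. -/
def rlMul (x y : A) : A :=
  Structure.funMap (L := rlLanguage pointed) (RLSymbol.mul : RLSymbol pointed 2) ![x, y]

/-- The residual `x → y`. -/
def rlImp (x y : A) : A :=
  Structure.funMap (L := rlLanguage pointed) (RLSymbol.imp : RLSymbol pointed 2) ![x, y]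

/-- The monoid unit. -/
def rlOne : A :=
  Structure.funMap (L := rlLanguage pointed) (RLSymbol.one : RLSymbol pointed 0) ![]

/-- The lattice order: `x ≤ y` iff `x ∧ y = x`. -/
def rlLe (x y : A) : Prop := rlInf pointed x y = x

/-- `A` is a commutative (pointed) residuated lattice.  In the pointed case the additional constant
is arbitrary. -/
structure IsCommResiduatedLattice (A : Type w) [(rlLanguage pointed).Structure A] : Prop where
  inf_comm : ∀ x y : A, rlInf pointed x y = rlInf pointed y x
  inf_assoc : ∀ x y z : A,
    rlInf pointed (rlInf pointed x y) z = rlInf pointed x (rlInf pointed y z)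
  sup_comm : ∀ x y : A, rlSup pointed x y = rlSup pointed y x
  sup_assoc : ∀ x y z : A,
    rlSup pointed (rlSup pointed x y) z = rlSup pointed x (rlSup pointed y z)
  inf_sup_self : ∀ x y : A, rlInf pointed x (rlSup pointed x y) = x
  sup_inf_self : ∀ x y : A, rlSup pointed x (rlInf pointed x y) = x
  mul_comm : ∀ x y : A, rlMul pointed x y = rlMul pointed y x
  mul_assoc : ∀ x y z : A,
    rlMul pointed (rlMul pointed x y) z = rlMul pointed x (rlMul pointed y z)
  one_mul : ∀ x : A, rlMul pointed (rlOne pointed) x = x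
  residuation : ∀ x y z : A,
    rlLe pointed (rlMul pointed x y) z ↔ rlLe pointed x (rlImp pointed y z)

/-- `A` is totally ordered. -/
def IsTotallyOrdered (A : Type w) [(rlLanguage pointed).Structure A] : Prop :=
  ∀ x y : A, rlLe pointed x y ∨ rlLe pointed y x

/-- `V` is a variety of semilinear commutative (pointed) residuated lattices: a variety of
commutative (pointed) residuated lattices that is generated by its totally ordered members. -/
structure IsSemilinearCRLVariety (V : Set (Bundled.{w} (rlLanguage pointed).Structure)) :
    Prop where
  isVariety : IsVariety V
  isCommResiduatedLattice : ∀ A ∈ V, IsCommResiduatedLattice pointed A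
  semilinear : V = generatedVariety {A ∈ V | IsTotallyOrdered pointed A}

end ResiduatedLattices

end UA

namespace UA

/-! ### Congruences, quotients and essential embeddings in an arbitrary signature. -/

section Congruences

variable {L : FirstOrder.Language.{u, v}}

/-! Both directions rest on one Zorn argument, `IsCongruence.exists_quotient_avoiding`: a congruence
maximal among those that avoid given pairs yields a quotient in which every nontrivial congruence
collapses one of these pairs. If the pairs are the distinct pairs of an embedded algebra, that
algebra becomes essential in the quotient, and essential extensions preserve finite subdirect
irreducibility (`IsEssentialEmbedding.isFSI`).

Amalgamation gives essential amalgamation: in an amalgam D of B and C over A, factor by a congruence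
maximal among those trivial on B. The quotient is FSI because B is essential in it, and C survives
because it is essential over A, which is embedded through B.

Conversely, a product of commuting squares is an amalgam once the squares separate points. To
separate b from b', pass to a quotient P of B with a least nontrivial congruence, one that
identifies their images. Its kernel restricts to α on A. Extend α to C, enlarge it maximally without
changing the restriction to A, and obtain an FSI quotient Q of C essential over A/α. An essential
amalgam of P and Q over A/α gives the square.

Semilinear varieties satisfy what this argument uses. Congruences are controlled by the elements
below 1 that are congruent to 1, whence the extension property. By prelinearity the FSI members are
exactly the chains, and a subalgebra of a chain is a chain. -/

theorem IsCongruence.ker {A B : Type*} [L.Structure A] [L.Structure B] (f : A →[L] B) :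
    IsCongruence (L := L) (Setoid.ker f) := by
  intro n g x y h
  rw [Setoid.ker_def, f.map_fun, f.map_fun]
  exact congrArg _ (funext h)

theorem IsCongruence.comap {A B : Type w} [L.Structure A] [L.Structure B] (f : A →[L] B)
    {θ : Setoid B} (hθ : IsCongruence (L := L) θ) : IsCongruence (L := L) (θ.comap f) := by
  intro n g x y h
  rw [Setoid.comap_rel, f.map_fun, f.map_fun]
  exact hθ n g _ _ h

theorem isCongruence_bot {A : Type w} [L.Structure A] :
    IsCongruence (L := L) (⊥ : Setoid A) := by
  intro n g x y h
  rw [show x = y from funext h]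

/-- A congruence that avoids a set of pairs can be enlarged to a maximal such congruence. -/
theorem IsCongruence.exists_maximal_avoiding {A : Type w} [L.Structure A] {θ₀ : Setoid A}
    (hθ₀ : IsCongruence (L := L) θ₀) (T : Set (A × A)) (hT : ∀ p ∈ T, ¬ θ₀ p.1 p.2) :
    ∃ θ, θ₀ ≤ θ ∧
      Maximal (fun θ : Setoid A => IsCongruence (L := L) θ ∧ ∀ p ∈ T, ¬ θ p.1 p.2) θ := by
  refine zorn_le_nonempty₀ {θ : Setoid A | IsCongruence (L := L) θ ∧ ∀ p ∈ T, ¬ θ p.1 p.2}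
    (fun c hc hchain y hy => ?_) θ₀ ⟨hθ₀, hT⟩
  have hdir : ∀ θ ∈ c, ∀ ψ ∈ c, ∃ χ ∈ c, θ ≤ χ ∧ ψ ≤ χ := fun θ h ψ h' =>
    hchain.directedOn θ h ψ h'
  let U : Setoid A :=
    { r := fun a b => ∃ θ ∈ c, θ a b
      iseqv := by
        refine ⟨fun a => ⟨y, hy, Setoid.refl' _ _⟩, ?_, ?_⟩
        · rintro a b ⟨θ, h, hab⟩
          exact ⟨θ, h, Setoid.symm' _ hab⟩
        · rintro a b d ⟨θ, h, hab⟩ ⟨ψ, h', hbd⟩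
          obtain ⟨χ, hχ, h₁, h₂⟩ := hdir θ h ψ h'
          exact ⟨χ, hχ, Setoid.trans' _ (h₁ hab) (h₂ hbd)⟩ }
  refine ⟨U, ⟨?_, ?_⟩, fun z hz a b hab => ⟨z, hz, hab⟩⟩
  · intro n f x x' h
    choose θ hθ hxy using (show ∀ i, ∃ θ ∈ c, θ (x i) (x' i) from h)
    -- Arities are finite, so a single member of the chain witnesses all argument pairs at once.
    have key : ∀ s : Finset (Fin n), ∃ χ ∈ c, ∀ i ∈ s, θ i ≤ χ := by
      intro s
      induction s using Finset.induction_on with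
      | empty => exact ⟨y, hy, by simp⟩
      | insert i s _ ih =>
        obtain ⟨χ, hχ, h₁⟩ := ih
        obtain ⟨ω, hω, h₂, h₃⟩ := hdir χ hχ (θ i) (hθ i)
        refine ⟨ω, hω, fun j hj => ?_⟩
        rcases Finset.mem_insert.1 hj with rfl | hj
        · exact h₃
        · exact (h₁ j hj).trans h₂
    obtain ⟨χ, hχ, h₁⟩ := key Finset.univ
    exact ⟨χ, hχ, (hc hχ).1 n f x x' fun i => h₁ i (Finset.mem_univ i) (hxy i)⟩
  · rintro p hp ⟨θ, h, hθ⟩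
    exact (hc h).2 p hp hθ

/-- The operations on the quotient of an algebra by an equivalence relation. -/
@[reducible] noncomputable def quotientAlgebra [L.IsAlgebraic] {A : Type w} [L.Structure A]
    (θ : Setoid A) : L.Structure (Quotient θ) where
  funMap f x := Quotient.mk θ (Structure.funMap f fun i => (x i).out)
  RelMap r _ := isEmptyElim r

theorem IsCongruence.exists_quotient [L.IsAlgebraic] {A : Type w} [L.Structure A] {θ : Setoid A}
    (hθ : IsCongruence (L := L) θ) :
    ∃ (Q : Bundled.{w} L.Structure) (q : A →[L] Q),
      Function.Surjective q ∧ ∀ a b, q a = q b ↔ θ a b := by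
  refine ⟨⟨Quotient θ, quotientAlgebra θ⟩,
    @Hom.mk L A (Quotient θ) _ (quotientAlgebra θ) (Quotient.mk θ) ?_ ?_,
    Quotient.mk_surjective, fun a b => Quotient.eq⟩
  · intro n f x
    exact Quotient.sound (hθ n f _ _ fun i => Setoid.symm' _ (Quotient.mk_out (s := θ) (x i)))
  · intro n r
    exact isEmptyElim r

/-- The quotient of an algebra by a maximal one of the congruences that avoid a set of pairs. -/
theorem IsCongruence.exists_quotient_avoiding [L.IsAlgebraic] {A : Type w} [L.Structure A]
    {θ₀ : Setoid A} (hθ₀ : IsCongruence (L := L) θ₀) (T : Set (A × A))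
    (hT : ∀ p ∈ T, ¬ θ₀ p.1 p.2) :
    ∃ (Q : Bundled.{w} L.Structure) (q : A →[L] Q), Function.Surjective q ∧
      (∀ a b, θ₀ a b → q a = q b) ∧ (∀ p ∈ T, q p.1 ≠ q p.2) ∧
      ∀ χ : Setoid Q, IsCongruence (L := L) χ → χ ≠ ⊥ → ∃ p ∈ T, χ (q p.1) (q p.2) := by
  obtain ⟨θ, hle, ⟨hθ, hθT⟩, hmax⟩ := hθ₀.exists_maximal_avoiding T hT
  obtain ⟨Q, q, hq, hker⟩ := hθ.exists_quotient
  refine ⟨Q, q, hq, fun a b h => (hker a b).2 (hle h), fun p hp h => hθT p hp ((hker _ _).1 h),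
    fun χ hχ hne => ?_⟩
  by_contra! hcon
  refine hne (le_bot_iff.1 fun a b hab => ?_)
  obtain ⟨a, rfl⟩ := hq a
  obtain ⟨b, rfl⟩ := hq b
  -- If χ collapsed no pair of T, its pullback would still avoid T, and maximality would put it
  -- below the kernel of q.
  refine (hker a b).2 (hmax (y := χ.comap q) ⟨hχ.comap q, hcon⟩ (fun x y h => ?_) hab)
  rw [Setoid.comap_rel, (hker x y).2 h]

/-- An algebra with a pair of distinct elements that all nontrivial congruences identify is
finitely subdirectly irreducible. -/
theorem isFSI_of_monolith {A : Type w} [L.Structure A] {a b : A} (hab : a ≠ b)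
    (h : ∀ χ : Setoid A, IsCongruence (L := L) χ → χ ≠ ⊥ → χ a b) : IsFSI L A := by
  intro S _ _ hS hbot
  by_contra hcon
  refine hab ?_
  have : (sInf S) a b := fun θ hθ => h θ (hS θ hθ) fun e => hcon (e ▸ hθ)
  rwa [hbot] at this

/-- Contrapositive form, with points of the range replaced by points of the domain: a congruence
trivial on the image is trivial. -/
theorem isEssentialEmbedding_iff {A B : Type w} [L.Structure A] [L.Structure B] (φ : A ↪[L] B) :
    IsEssentialEmbedding φ ↔ ∀ θ : Setoid B, IsCongruence (L := L) θ →
      (∀ x y, θ (φ x) (φ y) → x = y) → θ = ⊥ := by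
  refine forall₂_congr fun θ _ => ?_
  rw [← not_imp_not, not_not, not_not]
  refine imp_congr_left ⟨fun h x y hxy => ?_, fun h => le_bot_iff.1 ?_⟩
  · have : (θ.comap (Subtype.val : φ.toHom.range → B))
        ⟨φ x, Hom.mem_range_self _ _⟩ ⟨φ y, Hom.mem_range_self _ _⟩ := hxy
    rw [h] at this
    exact φ.injective (congrArg Subtype.val this)
  · rintro ⟨_, x, rfl⟩ ⟨_, y, rfl⟩ hxy
    exact Subtype.ext (congrArg φ (h x y hxy))

/-- An essential extension of a finitely subdirectly irreducible algebra is finitely subdirectly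
irreducible. -/
theorem IsEssentialEmbedding.isFSI {A B : Type w} [L.Structure A] [L.Structure B] {φ : A ↪[L] B}
    (hφ : IsEssentialEmbedding φ) (hA : IsFSI L A) : IsFSI L B := by
  rw [isEssentialEmbedding_iff] at hφ
  intro S hfin hne hS hbot
  -- Restriction to A commutes with intersections, so some member of the family restricts trivially
  -- to A; essentiality then makes that member trivial.
  have hmem := hA ((fun θ : Setoid B => θ.comap φ) '' S) (hfin.image _) (hne.image _)
    (by rintro _ ⟨θ, hθ, rfl⟩; exact (hS θ hθ).comap φ.toHom)
    (le_bot_iff.1 fun x y hxy => by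
      have : (sInf S) (φ x) (φ y) := fun θ hθ => hxy _ ⟨θ, hθ, rfl⟩
      rw [hbot] at this
      exact φ.injective this)
  obtain ⟨θ, hθ, e⟩ := hmem
  rwa [← hφ θ (hS θ hθ) fun x y hxy => by
    have : (θ.comap φ) x y := hxy
    change θ.comap φ = ⊥ at e
    rwa [e] at this]

/-- Equal kernels make the induced map both well defined and injective. This embeds A/α into the
quotients of both sides of a span. -/
theorem exists_lift_of_surjective [L.IsAlgebraic] {A B C : Type w} [L.Structure A] [L.Structure B]
    [L.Structure C] (f : A →[L] B) (hf : Function.Surjective f) (g : A →[L] C)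
    (h : ∀ a b, f a = f b ↔ g a = g b) : ∃ k : B ↪[L] C, ∀ a, k (f a) = g a := by
  have hinv : ∀ b, f (Function.surjInv hf b) = b := Function.surjInv_eq hf
  have hk : ∀ a, g (Function.surjInv hf (f a)) = g a := fun a => (h _ _).1 (hinv _)
  let k : B →[L] C :=
    { toFun := fun b => g (Function.surjInv hf b)
      map_fun' := by
        intro n F x
        refine Eq.trans ?_ (g.map_fun F _)
        refine (h _ _).1 ?_
        rw [hinv, f.map_fun]
        exact congrArg _ (funext fun i => (hinv (x i)).symm)
      map_rel' := fun r _ => isEmptyElim r }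
  refine ⟨Embedding.ofInjective (f := k) fun b b' hb => ?_, hk⟩
  rw [← hinv b, ← hinv b']
  exact (h _ _).2 hb

/-- The congruence extension property, for embeddings instead of subalgebras. -/
theorem CongruenceExtensionProperty.exists_extension {K : Set (Bundled.{w} L.Structure)}
    (hK : CongruenceExtensionProperty K) {A B : Bundled.{w} L.Structure} (hB : B ∈ K)
    (i : A ↪[L] B) {α : Setoid A} (hα : IsCongruence (L := L) α) :
    ∃ ψ : Setoid B, IsCongruence (L := L) ψ ∧ ∀ x y, ψ (i x) (i y) ↔ α x y := by
  -- The congruence is carried to the range of i along the isomorphism of A with its image.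
  obtain ⟨ψ, hψ, e⟩ := hK B hB i.toHom.range (α.comap i.equivRange.symm)
    (hα.comap i.equivRange.symm.toHom)
  refine ⟨ψ, hψ, fun x y => ?_⟩
  have := congrArg (fun s : Setoid i.toHom.range => s (i.equivRange x) (i.equivRange y)) e
  simpa [Setoid.comap_rel] using this

end Congruences

/-! ### Amalgamation in varieties and essential amalgamation of their FSI members. -/

section Varieties

variable {L : FirstOrder.Language.{u, v}} {V : Set (Bundled.{w} L.Structure)}

theorem IsVariety.nonempty_of_mem (hV : IsVariety V) {A : Bundled.{w} L.Structure} (hA : A ∈ V) :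
    Nonempty A := by
  obtain ⟨E, rfl⟩ := hV
  exact hA.1

theorem IsVariety.of_surjective (hV : IsVariety V) {A B : Bundled.{w} L.Structure} (hA : A ∈ V)
    (f : A →[L] B) (hf : Function.Surjective f) : B ∈ V := by
  obtain ⟨E, rfl⟩ := hV
  refine ⟨hA.1.map f, fun e he x => ?_⟩
  obtain ⟨y, rfl⟩ := hf.comp_left x
  change e.1.realize (f ∘ y) = e.2.realize (f ∘ y)
  rw [HomClass.realize_term, HomClass.realize_term, hA.2 e he y]

/-- A variety contains every nonempty algebra whose points are separated by homomorphisms into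
members of the variety. -/
theorem IsVariety.of_separating (hV : IsVariety V) {A : Bundled.{w} L.Structure} [Nonempty A]
    (h : ∀ a b : A, a ≠ b → ∃ B ∈ V, ∃ f : A →[L] B, f a ≠ f b) : A ∈ V := by
  obtain ⟨E, rfl⟩ := hV
  refine ⟨inferInstance, fun e he x => ?_⟩
  by_contra hne
  obtain ⟨B, hB, f, hf⟩ := h _ _ hne
  refine hf ?_
  rw [← HomClass.realize_term, ← HomClass.realize_term, hB.2 e he]

/-- The direct product, given by the two properties used: jointly injective projections and lifting
of families of maps. -/
theorem exists_product [L.IsAlgebraic] {I : Type w} (D : I → Bundled.{w} L.Structure) :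
    ∃ (P : Bundled.{w} L.Structure) (π : ∀ i, P →[L] D i),
      (∀ x y, (∀ i, π i x = π i y) → x = y) ∧
      ∀ (B : Bundled.{w} L.Structure) (f : ∀ i, B →[L] D i),
        ∃ F : B →[L] P, ∀ i b, π i (F b) = f i b := by
  let S : L.Structure (∀ i, D i) :=
    { funMap := fun f x i => Structure.funMap f fun j => x j i
      RelMap := fun r _ => isEmptyElim r }
  refine ⟨⟨∀ i, D i, S⟩, fun i => @Hom.mk L (∀ i, D i) (D i) S _ (fun x => x i)
    (fun _ _ => rfl) (fun r => isEmptyElim r), fun x y h => funext h, fun B f =>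
    ⟨@Hom.mk L B (∀ i, D i) _ S (fun b i => f i b)
      (fun F x => funext fun i => (f i).map_fun F x) (fun r => isEmptyElim r),
      fun _ _ => rfl⟩⟩

/-- Commuting squares over a span, with fourth corners in a variety, yield an amalgam in the
variety if they jointly separate the points of both targets. -/
theorem IsVariety.exists_amalgam [L.IsAlgebraic] (hV : IsVariety V)
    {A B C : Bundled.{w} L.Structure} (i₁ : A ↪[L] B) (i₂ : A ↪[L] C) [Nonempty B] {I : Type w}
    (D : I → Bundled.{w} L.Structure) (hD : ∀ i, D i ∈ V)
    (f : ∀ i, B →[L] D i) (g : ∀ i, C →[L] D i) (hfg : ∀ i a, f i (i₁ a) = g i (i₂ a))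
    (hf : ∀ b b', (∀ i, f i b = f i b') → b = b') (hg : ∀ c c', (∀ i, g i c = g i c') → c = c') :
    ∃ (Q : Bundled.{w} L.Structure) (j₁ : B ↪[L] Q) (j₂ : C ↪[L] Q),
      Q ∈ V ∧ j₁.comp i₁ = j₂.comp i₂ := by
  obtain ⟨P, π, hπ, hlift⟩ := exists_product D
  obtain ⟨F, hF⟩ := hlift B f
  obtain ⟨G, hG⟩ := hlift C g
  have : Nonempty P := Nonempty.map F inferInstance
  refine ⟨P, Embedding.ofInjective (f := F) fun b b' h => hf b b' fun i => ?_,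
    Embedding.ofInjective (f := G) fun c c' h => hg c c' fun i => ?_, ?_, ?_⟩
  · rw [← hF, h, hF]
  · rw [← hG, h, hG]
  · refine hV.of_separating fun x y hxy => ?_
    by_contra! hcon
    exact hxy (hπ x y fun i => hcon (D i) (hD i) (π i))
  · ext a
    refine hπ _ _ fun i => ?_
    change π i (F (i₁ a)) = π i (G (i₂ a))
    rw [hF, hG, hfg]

/-- If a variety has the amalgamation property, its finitely subdirectly irreducible members have
the essential amalgamation property. -/
theorem IsVariety.essentialAmalgamation_fsi [L.IsAlgebraic] (hV : IsVariety V)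
    (h : Amalgamation V) : EssentialAmalgamation (fsi V) := by
  intro A B C i₁ i₂ hA hB hC hess
  obtain ⟨D, j₁, j₂, hD, hj⟩ := h A B C i₁ i₂ hA.1 hB.1 hC.1
  have hj' : ∀ a, j₁ (i₁ a) = j₂ (i₂ a) := fun a => DFunLike.congr_fun hj a
  -- Avoiding all distinct pairs from B keeps B embedded in Q and makes it essential there.
  obtain ⟨Q, q, hq, -, hT, hmax⟩ := (isCongruence_bot (L := L) (A := D)).exists_quotient_avoiding
    {p | ∃ b b' : B, b ≠ b' ∧ p = (j₁ b, j₁ b')}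
    (by rintro _ ⟨b, b', hne, rfl⟩ h; exact hne (j₁.injective h))
  have hk₁ : Function.Injective (q.comp j₁.toHom) := by
    intro b b' hb
    by_contra hne
    exact hT _ ⟨b, b', hne, rfl⟩ hb
  have hk₂ : Function.Injective (q.comp j₂.toHom) := by
    intro c c' hc
    -- On A the map from C agrees with the injective map from B, so its kernel is trivial on A,
    -- hence trivial by essentiality of i₂.
    have hbot := (isEssentialEmbedding_iff i₂).1 hess _ (IsCongruence.ker (q.comp j₂.toHom))
      fun x y hxy => i₁.injective (hk₁ (by
        change q (j₂ (i₂ x)) = q (j₂ (i₂ y)) at hxy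
        change q (j₁ (i₁ x)) = q (j₁ (i₁ y))
        rw [hj', hj', hxy]))
    have : Setoid.ker (q.comp j₂.toHom) c c' := hc
    rwa [hbot] at this
  have hess₁ : IsEssentialEmbedding (Embedding.ofInjective hk₁) := by
    refine (isEssentialEmbedding_iff _).2 fun θ hθ hinj => ?_
    by_contra hne
    obtain ⟨_, ⟨b, b', hbb, rfl⟩, hχ⟩ := hmax θ hθ hne
    exact hbb (hinj b b' hχ)
  refine ⟨Q, Embedding.ofInjective hk₁, Embedding.ofInjective hk₂,
    ⟨hV.of_surjective hD q hq, hess₁.isFSI hB.2⟩, ?_⟩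
  ext a
  exact congrArg q (hj' a)

/-- Over a span in a variety, points of the first target can be separated by a commuting square
into a finitely subdirectly irreducible member. -/
theorem IsVariety.exists_separating_square [L.IsAlgebraic] (hV : IsVariety V)
    (hcep : CongruenceExtensionProperty V)
    (hsub : ∀ A B : Bundled.{w} L.Structure, Nonempty A → B ∈ fsi V → (A ↪[L] B) → A ∈ fsi V)
    (hess : EssentialAmalgamation (fsi V)) {A B C : Bundled.{w} L.Structure}
    (i₁ : A ↪[L] B) (i₂ : A ↪[L] C) (hA : A ∈ V) (hB : B ∈ V) (hC : C ∈ V) {b b' : B}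
    (hne : b ≠ b') : ∃ (D : Bundled.{w} L.Structure) (f : B →[L] D) (g : C →[L] D),
      D ∈ V ∧ (∀ a, f (i₁ a) = g (i₂ a)) ∧ f b ≠ f b' := by
  obtain ⟨P, p, hp, -, hpb, hPmax⟩ :=
    (isCongruence_bot (L := L) (A := B)).exists_quotient_avoiding {(b, b')}
      (by rintro _ rfl h; exact hne h)
  simp only [Set.mem_singleton_iff, forall_eq, exists_eq_left] at hpb hPmax
  have hP : P ∈ fsi V := ⟨hV.of_surjective hB p hp, isFSI_of_monolith hpb hPmax⟩
  have hα : IsCongruence (L := L) (Setoid.ker (p.comp i₁.toHom)) := IsCongruence.ker _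
  obtain ⟨A', r, hr, hrker⟩ := hα.exists_quotient
  obtain ⟨k₁, hk₁⟩ := exists_lift_of_surjective r hr (p.comp i₁.toHom) hrker
  have hA' : A' ∈ fsi V := hsub A' P ((hV.nonempty_of_mem hA).map r) hP k₁
  obtain ⟨ψ, hψ, hψα⟩ := hcep.exists_extension hC i₂ hα
  -- The kernel contains ψ and avoids every pair of A outside α, so it restricts to exactly α, and
  -- maximality makes A/α essential in Q.
  obtain ⟨Q, q, hq, hqψ, hqT, hQmax⟩ := hψ.exists_quotient_avoiding
    {z | ∃ x y : A, r x ≠ r y ∧ z = (i₂ x, i₂ y)}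
    (by rintro _ ⟨x, y, hxy, rfl⟩ h; exact hxy ((hrker x y).2 ((hψα x y).1 h)))
  obtain ⟨k₂, hk₂⟩ := exists_lift_of_surjective r hr (q.comp i₂.toHom) fun x y =>
    ⟨fun h => hqψ _ _ ((hψα x y).2 ((hrker x y).1 h)), fun h => by
      by_contra hxy
      exact hqT _ ⟨x, y, hxy, rfl⟩ h⟩
  have hk₂ess : IsEssentialEmbedding k₂ := by
    refine (isEssentialEmbedding_iff _).2 fun θ hθ hinj => ?_
    by_contra hbot
    obtain ⟨_, ⟨x, y, hxy, rfl⟩, hχ⟩ := hQmax θ hθ hbot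
    refine hxy (hinj _ _ ?_)
    rw [hk₂, hk₂]
    exact hχ
  have hQ : Q ∈ fsi V := ⟨hV.of_surjective hC q hq, hk₂ess.isFSI hA'.2⟩
  obtain ⟨D, j₁, j₂, hD, hj⟩ := hess A' P Q k₁ k₂ hA' hP hQ hk₂ess
  refine ⟨D, j₁.toHom.comp p, j₂.toHom.comp q, hD.1, fun a => ?_,
    fun h => hpb (j₁.injective h)⟩
  have := DFunLike.congr_fun hj (r a)
  change j₁ (k₁ (r a)) = j₂ (k₂ (r a)) at this
  rw [hk₁, hk₂] at this
  exact this

/-- A variety with the congruence extension property whose finitely subdirectly irreducible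
members are closed under subalgebras has the amalgamation property if and only if its finitely
subdirectly irreducible members have the essential amalgamation property. -/
theorem IsVariety.amalgamation_iff [L.IsAlgebraic] (hV : IsVariety V)
    (hcep : CongruenceExtensionProperty V)
    (hsub : ∀ A B : Bundled.{w} L.Structure, Nonempty A → B ∈ fsi V → (A ↪[L] B) → A ∈ fsi V) :
    Amalgamation V ↔ EssentialAmalgamation (fsi V) := by
  refine ⟨hV.essentialAmalgamation_fsi, fun hess A B C i₁ i₂ hA hB hC => ?_⟩
  have := hV.nonempty_of_mem hB
  -- One square for each pair of distinct points of B or of C; for C the span is reversed.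
  have hsq : ∀ z : {z : B × B // z.1 ≠ z.2} ⊕ {z : C × C // z.1 ≠ z.2},
      ∃ (D : Bundled.{w} L.Structure) (f : B →[L] D) (g : C →[L] D),
        D ∈ V ∧ (∀ a, f (i₁ a) = g (i₂ a)) ∧
        Sum.elim (fun z => f z.1.1 ≠ f z.1.2) (fun z => g z.1.1 ≠ g z.1.2) z := by
    rintro (⟨z, hz⟩ | ⟨z, hz⟩)
    · exact hV.exists_separating_square hcep hsub hess i₁ i₂ hA hB hC hz
    · obtain ⟨D, g, f, hD, hgf, hg⟩ :=
        hV.exists_separating_square hcep hsub hess i₂ i₁ hA hC hB hz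
      exact ⟨D, f, g, hD, fun a => (hgf a).symm, hg⟩
  choose D f g hD hfg hsep using hsq
  refine hV.exists_amalgam i₁ i₂ D hD f g hfg (fun b b' h => ?_) (fun c c' h => ?_)
  · by_contra hne
    exact hsep (Sum.inl ⟨(b, b'), hne⟩) (h _)
  · by_contra hne
    exact hsep (Sum.inr ⟨(c, c'), hne⟩) (h _)

end Varieties

end UA

namespace UA

/-! ### Congruences of commutative residuated lattices through the negative cone. -/

section OrderedAlgebra

/-- Commutative residuated lattices, as an extension of the order-theoretic hierarchy. -/
class CommResLattice (A : Type*) extends Lattice A, CommMonoid A where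
  /-- The residual of the multiplication. -/
  imp : A → A → A
  residuation : ∀ x y z : A, x * y ≤ z ↔ x ≤ imp y z

namespace CommResLattice

variable {A B : Type*} [CommResLattice A] [CommResLattice B]

instance : IsOrderedMonoid A where
  mul_le_mul_left x y h z :=
    (residuation x z _).2 (h.trans ((residuation y z (y * z)).1 le_rfl))

theorem imp_mul_le (x y : A) : imp x y * x ≤ y := (residuation _ _ _).2 le_rfl

theorem mul_sup_le {a x y z : A} (hx : a * x ≤ z) (hy : a * y ≤ z) : a * (x ⊔ y) ≤ z := by
  rw [mul_comm] at *
  rw [residuation]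
  exact sup_le ((residuation _ _ _).1 (mul_comm a x ▸ hx)) ((residuation _ _ _).1 hy)

theorem one_le_imp {x y : A} : 1 ≤ imp x y ↔ x ≤ y := by
  rw [← residuation, one_mul]

/-- Equivalence relations compatible with the operations of a commutative residuated lattice. -/
structure IsCong (θ : Setoid A) : Prop where
  inf : ∀ {x x' y y'}, θ x x' → θ y y' → θ (x ⊓ y) (x' ⊓ y')
  sup : ∀ {x x' y y'}, θ x x' → θ y y' → θ (x ⊔ y) (x' ⊔ y')
  mul : ∀ {x x' y y'}, θ x x' → θ y y' → θ (x * y) (x' * y')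
  imp : ∀ {x x' y y'}, θ x x' → θ y y' → θ (imp x y) (imp x' y')

/-- The relation induced by a submonoid of the negative cone. -/
def submonoidSetoid (M : Submonoid A) : Setoid A where
  r x y := ∃ a ∈ M, a * x ≤ y ∧ a * y ≤ x
  iseqv := by
    refine ⟨fun x => ⟨1, M.one_mem, by simp⟩, ?_, ?_⟩
    · rintro x y ⟨a, ha, h₁, h₂⟩
      exact ⟨a, ha, h₂, h₁⟩
    · rintro x y z ⟨a, ha, h₁, h₂⟩ ⟨b, hb, h₃, h₄⟩
      refine ⟨a * b, M.mul_mem ha hb, ?_, ?_⟩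
      · rw [mul_comm a b, mul_assoc]
        exact (mul_le_mul_right h₁ b).trans h₃
      · rw [mul_assoc]
        exact (mul_le_mul_right h₄ a).trans h₂

/-- Elements of M are at most 1, so the product of two witnesses lies below each and serves for both
arguments. -/
theorem submonoidSetoid_isCong {M : Submonoid A} (hM : ∀ a ∈ M, a ≤ 1) :
    IsCong (submonoidSetoid M) := by
  have left : ∀ {a b : A}, b ∈ M → a * b ≤ a := fun {a b} hb => mul_le_of_le_one_right' (hM b hb)
  have right : ∀ {a b : A}, a ∈ M → a * b ≤ b := fun {a b} ha => mul_le_of_le_one_left' (hM a ha)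
  constructor
  · rintro x x' y y' ⟨a, ha, h₁, h₂⟩ ⟨b, hb, h₃, h₄⟩
    exact ⟨a * b, M.mul_mem ha hb,
      le_inf ((mul_le_mul' (left hb) inf_le_left).trans h₁)
        ((mul_le_mul' (right ha) inf_le_right).trans h₃),
      le_inf ((mul_le_mul' (left hb) inf_le_left).trans h₂)
        ((mul_le_mul' (right ha) inf_le_right).trans h₄)⟩
  · rintro x x' y y' ⟨a, ha, h₁, h₂⟩ ⟨b, hb, h₃, h₄⟩
    exact ⟨a * b, M.mul_mem ha hb,
      mul_sup_le (((mul_le_mul_left (left hb) x).trans h₁).trans le_sup_left)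
        (((mul_le_mul_left (right ha) y).trans h₃).trans le_sup_right),
      mul_sup_le (((mul_le_mul_left (left hb) x').trans h₂).trans le_sup_left)
        (((mul_le_mul_left (right ha) y').trans h₄).trans le_sup_right)⟩
  · rintro x x' y y' ⟨a, ha, h₁, h₂⟩ ⟨b, hb, h₃, h₄⟩
    refine ⟨a * b, M.mul_mem ha hb, ?_, ?_⟩
    · rw [mul_mul_mul_comm]
      exact mul_le_mul' h₁ h₃
    · rw [mul_mul_mul_comm]
      exact mul_le_mul' h₂ h₄
  · have key : ∀ {a b x x' y y' : A}, a * x' ≤ x → b * y ≤ y' →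
        a * b * imp x y ≤ imp x' y' := by
      intro a b x x' y y' h₁ h₂
      rw [← residuation]
      calc a * b * imp x y * x' = b * (imp x y * (a * x')) := by
            ac_rfl
        _ ≤ b * (imp x y * x) := mul_le_mul_right (mul_le_mul_right h₁ _) _
        _ ≤ b * y := mul_le_mul_right (imp_mul_le x y) _
        _ ≤ y' := h₂
    rintro x x' y y' ⟨a, ha, h₁, h₂⟩ ⟨b, hb, h₃, h₄⟩
    exact ⟨a * b, M.mul_mem ha hb, key h₂ h₃, key h₁ h₄⟩

/-- The element of the negative cone that measures how far `x` and `y` are from being equal. -/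
def dist (x y : A) : A := imp x y ⊓ imp y x ⊓ 1

theorem dist_le_one (x y : A) : dist x y ≤ 1 := inf_le_right

theorem dist_mul_le_right (x y : A) : dist x y * x ≤ y :=
  (mul_le_mul_left (inf_le_left.trans inf_le_left) x).trans (imp_mul_le x y)

theorem dist_mul_le_left (x y : A) : dist x y * y ≤ x :=
  (mul_le_mul_left (inf_le_left.trans inf_le_right) y).trans (imp_mul_le y x)

theorem eq_of_dist_eq_one {x y : A} (h : dist x y = 1) : x = y := by
  have h₁ := dist_mul_le_right x y
  have h₂ := dist_mul_le_left x y
  rw [h, one_mul] at h₁ h₂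
  exact le_antisymm h₁ h₂

/-- Replacing y by x turns `dist x y` into `dist x x`, which is 1. With `IsCong.rel_of_mul_le` this
shows that a congruence is determined by the elements below 1 congruent to 1. -/
theorem IsCong.dist_rel {θ : Setoid A} (hθ : IsCong θ) {x y : A} (h : θ x y) :
    θ (dist x y) 1 := by
  have hx : dist x x = 1 := by
    have : 1 ≤ CommResLattice.imp x x := one_le_imp.2 le_rfl
    simp [dist, this]
  have h' := Setoid.symm' θ h
  have := hθ.inf (hθ.inf (hθ.imp (Setoid.refl' θ x) h') (hθ.imp h' (Setoid.refl' θ x)))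
    (Setoid.refl' θ 1)
  change θ (dist x y) (dist x x) at this
  rwa [hx] at this

theorem IsCong.rel_of_mul_le {θ : Setoid A} (hθ : IsCong θ) {a x y : A} (ha : θ a 1)
    (h₁ : a * x ≤ y) (h₂ : a * y ≤ x) : θ x y := by
  have key : ∀ {x y : A}, a * x ≤ y → θ (x ⊓ y) x := by
    intro x y h
    have hx : θ (a * x) x := by simpa using hθ.mul ha (Setoid.refl' θ x)
    have := hθ.inf hx (Setoid.refl' θ y)
    rw [inf_eq_left.2 h] at this
    exact Setoid.trans' _ (Setoid.symm' _ this) hx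
  refine Setoid.trans' _ (Setoid.symm' _ (key h₁)) ?_
  rw [inf_comm]
  exact key h₂

/-- Congruences of commutative residuated lattices extend along embeddings. -/
theorem IsCong.exists_extension {i : A → B} (hi : Function.Injective i)
    (h_inf : ∀ x y, i (x ⊓ y) = i x ⊓ i y) (h_mul : ∀ x y, i (x * y) = i x * i y)
    (h_one : i 1 = 1) {θ : Setoid A} (hθ : IsCong θ) :
    ∃ ψ : Setoid B, IsCong ψ ∧ ∀ x y, ψ (i x) (i y) ↔ θ x y := by
  have hle : ∀ {x y}, i x ≤ i y ↔ x ≤ y := fun {x y} => by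
    rw [← inf_eq_left, ← h_inf, hi.eq_iff, inf_eq_left]
  -- The extension is induced by the images of the elements below 1 that θ relates to 1.
  let M : Submonoid B :=
    { carrier := {b | ∃ a, i a = b ∧ θ a 1 ∧ a ≤ 1}
      one_mem' := ⟨1, h_one, Setoid.refl' _ _, le_rfl⟩
      mul_mem' := by
        rintro _ _ ⟨a, rfl, ha, ha'⟩ ⟨b, rfl, hb, hb'⟩
        exact ⟨a * b, h_mul a b, by simpa using hθ.mul ha hb, mul_le_one' ha' hb'⟩ }
  refine ⟨submonoidSetoid M, submonoidSetoid_isCong ?_, fun x y => ⟨?_, fun h => ?_⟩⟩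
  · rintro _ ⟨a, rfl, -, ha⟩
    rw [← h_one, hle]
    exact ha
  · rintro ⟨_, ⟨a, rfl, ha, -⟩, h₁, h₂⟩
    rw [← h_mul, hle] at h₁ h₂
    exact hθ.rel_of_mul_le ha h₁ h₂
  · refine ⟨_, ⟨dist x y, rfl, hθ.dist_rel h, dist_le_one x y⟩, ?_, ?_⟩
    · rw [← h_mul, hle]
      exact dist_mul_le_right x y
    · rw [← h_mul, hle]
      exact dist_mul_le_left x y

/-- Expand 1 = (a ⊔ c)(a ⊔ b): every term except bc is below a. -/
theorem sup_mul_eq_one {a b c : A} (ha : a ≤ 1) (hb : b ≤ 1) (hab : a ⊔ b = 1) (hc : c ≤ 1)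
    (hac : a ⊔ c = 1) : a ⊔ b * c = 1 := by
  refine le_antisymm (sup_le ha (mul_le_one' hb hc)) ?_
  have h₁ : a * (a ⊔ c) ≤ a ⊔ b * c := by
    rw [hac, mul_one]
    exact le_sup_left
  have h₂ : b * (a ⊔ c) ≤ a ⊔ b * c :=
    mul_sup_le ((mul_le_of_le_one_left' hb).trans le_sup_left) le_sup_right
  calc (1 : A) = (a ⊔ c) * (a ⊔ b) := by rw [hac, hab, mul_one]
    _ ≤ a ⊔ b * c := mul_sup_le (by rwa [mul_comm]) (by rwa [mul_comm])

theorem sup_pow_eq_one {a b : A} (ha : a ≤ 1) (hb : b ≤ 1) (hab : a ⊔ b = 1) (n : ℕ) :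
    a ⊔ b ^ n = 1 := by
  induction n with
  | zero => simpa using ha
  | succ n ih =>
    rw [pow_succ']
    exact sup_mul_eq_one ha hb hab (pow_le_one' hb n) ih

/-- If `1` is the join of `a, b ≤ 1`, the congruences generated by `a` and by `b` meet trivially. -/
theorem submonoidSetoid_powers_inf {a b : A} (ha : a ≤ 1) (hb : b ≤ 1) (hab : a ⊔ b = 1) {x y : A}
    (h₁ : submonoidSetoid (Submonoid.powers a) x y)
    (h₂ : submonoidSetoid (Submonoid.powers b) x y) : x = y := by
  obtain ⟨_, ⟨m, rfl⟩, h₁, h₁'⟩ := h₁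
  obtain ⟨_, ⟨n, rfl⟩, h₂, h₂'⟩ := h₂
  have h : a ^ m ⊔ b ^ n = 1 := by
    rw [sup_comm]
    refine sup_pow_eq_one (pow_le_one' hb n) ha ?_ m
    rw [sup_comm]
    exact sup_pow_eq_one ha hb hab n
  have key : ∀ {x y : A}, a ^ m * x ≤ y → b ^ n * x ≤ y → x ≤ y := by
    intro x y h₁ h₂
    rw [← one_mul x, ← h, mul_comm]
    exact mul_sup_le (by rwa [mul_comm]) (by rwa [mul_comm])
  exact le_antisymm (key h₁ h₂) (key h₁' h₂')

end CommResLattice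

end OrderedAlgebra

/-! ### Transfer to the signature of residuated lattices; FSI members as chains. -/

section Transfer

open CommResLattice

variable {pointed : Bool}

/-- The order-theoretic view of a commutative (pointed) residuated lattice. -/
@[reducible] def IsCommResiduatedLattice.toCommResLattice {A : Type w}
    [(rlLanguage pointed).Structure A] (h : IsCommResiduatedLattice pointed A) :
    CommResLattice A where
  toLattice :=
    letI : Max A := ⟨rlSup pointed⟩
    letI : Min A := ⟨rlInf pointed⟩
    Lattice.mk' h.sup_comm h.sup_assoc h.inf_comm h.inf_assoc h.sup_inf_self h.inf_sup_self
  mul := rlMul pointed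
  one := rlOne pointed
  mul_assoc := h.mul_assoc
  mul_comm := h.mul_comm
  one_mul := h.one_mul
  mul_one x := (h.mul_comm _ _).trans (h.one_mul x)
  imp := rlImp pointed
  residuation x y z := by
    let : Max A := ⟨rlSup pointed⟩
    let : Min A := ⟨rlInf pointed⟩
    let := Lattice.mk' h.sup_comm h.sup_assoc h.inf_comm h.inf_assoc h.sup_inf_self h.inf_sup_self
    exact (inf_eq_left (a := rlMul pointed x y)).symm.trans
      ((h.residuation x y z).trans (inf_eq_left (a := x)))

instance : (rlLanguage pointed).IsAlgebraic := fun _ => inferInstanceAs (IsEmpty Empty)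

theorem IsCommResiduatedLattice.rlLe_iff {A : Type w} [(rlLanguage pointed).Structure A]
    (h : IsCommResiduatedLattice pointed A) (x y : A) :
    letI := h.toCommResLattice
    rlLe pointed x y ↔ x ≤ y :=
  letI := h.toCommResLattice
  inf_eq_left (a := x)

theorem IsCommResiduatedLattice.isCongruence_iff {A : Type w} [(rlLanguage pointed).Structure A]
    (h : IsCommResiduatedLattice pointed A) (θ : Setoid A) :
    letI := h.toCommResLattice
    IsCongruence (L := rlLanguage pointed) θ ↔ IsCong θ := by
  let := h.toCommResLattice
  constructor
  · intro hθ
    have key : ∀ (f : RLSymbol pointed 2) {x x' y y' : A}, θ x x' → θ y y' →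
        θ (Structure.funMap (L := rlLanguage pointed) f ![x, y])
          (Structure.funMap (L := rlLanguage pointed) f ![x', y']) :=
      fun f {x x' y y'} hx hy => hθ 2 f _ _ (Fin.forall_fin_two.2 ⟨hx, hy⟩)
    exact ⟨key .inf, key .sup, key .mul, key .imp⟩
  · intro hθ n f x y hxy
    have hbin : ∀ z : Fin 2 → A, z = ![z 0, z 1] := fun z => by
      ext i; fin_cases i <;> rfl
    cases f with
    | inf => rw [hbin x, hbin y]; exact hθ.inf (hxy 0) (hxy 1)
    | sup => rw [hbin x, hbin y]; exact hθ.sup (hxy 0) (hxy 1)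
    | mul => rw [hbin x, hbin y]; exact hθ.mul (hxy 0) (hxy 1)
    | imp => rw [hbin x, hbin y]; exact hθ.imp (hxy 0) (hxy 1)
    | one => rw [Subsingleton.elim x y]
    | point _ => rw [Subsingleton.elim x y]

theorem map_binary {A B : Type w} [(rlLanguage pointed).Structure A]
    [(rlLanguage pointed).Structure B] (i : A →[rlLanguage pointed] B) (f : RLSymbol pointed 2)
    (x y : A) : i (Structure.funMap (L := rlLanguage pointed) f ![x, y]) =
      Structure.funMap (L := rlLanguage pointed) f ![i x, i y] := by
  refine (i.map_fun _ _).trans (congrArg (Structure.funMap (L := rlLanguage pointed) f) ?_)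
  ext j
  fin_cases j <;> rfl

theorem map_rlOne {A B : Type w} [(rlLanguage pointed).Structure A]
    [(rlLanguage pointed).Structure B] (i : A →[rlLanguage pointed] B) :
    i (rlOne pointed) = rlOne pointed := by
  refine (i.map_fun _ _).trans ?_
  exact congrArg _ (Subsingleton.elim _ _)

theorem IsVariety.mem_of_embedding {L : FirstOrder.Language.{u, v}}
    {V : Set (Bundled.{w} L.Structure)} (hV : IsVariety V) {A B : Bundled.{w} L.Structure}
    [Nonempty A] (hB : B ∈ V) (i : A ↪[L] B) : A ∈ V :=
  hV.of_separating fun _ _ hne => ⟨B, hB, i.toHom, i.injective.ne hne⟩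

/-- Varieties of commutative residuated lattices have the congruence extension property. -/
theorem IsVariety.congruenceExtensionProperty_of_isCommResiduatedLattice
    {V : Set (Bundled.{w} (rlLanguage pointed).Structure)} (hV : IsVariety V)
    (hres : ∀ A ∈ V, IsCommResiduatedLattice pointed A) : CongruenceExtensionProperty V := by
  intro B hB A θ hθ
  have hone : (rlOne pointed : B) ∈ A :=
    A.fun_mem (RLSymbol.one : RLSymbol pointed 0) _ fun i => i.elim0
  have : Nonempty (Bundled.of (c := (rlLanguage pointed).Structure) A) := ⟨⟨_, hone⟩⟩
  have hA : IsCommResiduatedLattice pointed A :=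
    hres _ (hV.mem_of_embedding (A := Bundled.of A) hB A.subtype)
  let := hA.toCommResLattice
  let := (hres B hB).toCommResLattice
  obtain ⟨ψ, hψ, hψθ⟩ := IsCong.exists_extension (i := (Subtype.val : A → B))
    Subtype.val_injective (map_binary A.subtype.toHom .inf) (map_binary A.subtype.toHom .mul)
    (map_rlOne A.subtype.toHom) ((hA.isCongruence_iff θ).1 hθ)
  exact ⟨ψ, ((hres B hB).isCongruence_iff ψ).2 hψ, Setoid.ext hψθ⟩

/-- Totally ordered commutative residuated lattices are finitely subdirectly irreducible. -/
theorem IsTotallyOrdered.isFSI {A : Type w} [(rlLanguage pointed).Structure A]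
    (h : IsCommResiduatedLattice pointed A) (htot : IsTotallyOrdered pointed A) :
    IsFSI (rlLanguage pointed) A := by
  let := h.toCommResLattice
  have hle : ∀ x y : A, x ≤ y ∨ y ≤ x := fun x y =>
    (htot x y).imp (h.rlLe_iff x y).1 (h.rlLe_iff y x).1
  have hrel : ∀ θ : Setoid A, IsCongruence (L := rlLanguage pointed) θ → θ ≠ ⊥ →
      ∃ a : A, a ≤ 1 ∧ a ≠ 1 ∧ θ a 1 := by
    intro θ hθ hne
    by_contra! hcon
    refine hne (le_bot_iff.1 fun x y hxy => ?_)
    by_contra hxy'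
    exact hcon (dist x y) (dist_le_one x y) (fun e => hxy' (eq_of_dist_eq_one e))
      (((h.isCongruence_iff θ).1 hθ).dist_rel hxy)
  have hconv : ∀ θ : Setoid A, IsCongruence (L := rlLanguage pointed) θ → ∀ a b : A, a ≤ b →
      b ≤ 1 → θ a 1 → θ b 1 := by
    intro θ hθ a b hab hb ha
    have := ((h.isCongruence_iff θ).1 hθ).sup ha (Setoid.refl' θ b)
    rwa [sup_eq_right.2 hab, sup_eq_left.2 hb] at this
  intro S hfin hne hS hbot
  by_contra hcon
  have hS' : ∀ θ ∈ S, θ ≠ ⊥ := fun θ hθ e => hcon (e ▸ hθ)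
  obtain ⟨θ₀, hθ₀⟩ := hne
  obtain ⟨a₀, ha₀, ha₀', -⟩ := hrel θ₀ (hS _ hθ₀) (hS' _ hθ₀)
  -- In a chain, the larger of two witnesses below 1 works for both congruences, by convexity. The
  -- element `a₀` only starts the induction at the empty family.
  have key : ∃ a : A, a ≤ 1 ∧ a ≠ 1 ∧ ∀ θ ∈ S, θ a 1 := by
    clear hbot hcon hθ₀
    induction S, hfin using Set.Finite.induction_on with
    | empty => exact ⟨a₀, ha₀, ha₀', by simp⟩
    | @insert θ S _ _ ih =>
      obtain ⟨a, ha, ha', haS⟩ := ih (fun θ h => hS θ (.inr h)) fun θ h => hS' θ (.inr h)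
      obtain ⟨b, hb, hb', hbθ⟩ := hrel θ (hS θ (.inl rfl)) (hS' θ (.inl rfl))
      rcases hle a b with hab | hab
      · refine ⟨b, hb, hb', ?_⟩
        rintro ψ (rfl | hψ)
        · exact hbθ
        · exact hconv ψ (hS ψ (.inr hψ)) a b hab hb (haS ψ hψ)
      · refine ⟨a, ha, ha', ?_⟩
        rintro ψ (rfl | hψ)
        · exact hconv ψ (hS ψ (.inl rfl)) b a hab ha hbθ
        · exact haS ψ hψ
  obtain ⟨a, -, ha', haS⟩ := key
  have : (sInf S) a 1 := fun θ hθ => haS θ hθ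
  rw [hbot] at this
  exact ha' this

/-- The prelinearity identity `((x → y) ∧ 1) ∨ ((y → x) ∧ 1) = 1`. -/
def Prelinear (pointed : Bool) (A : Type w) [(rlLanguage pointed).Structure A] : Prop :=
  ∀ x y : A, rlSup pointed (rlInf pointed (rlImp pointed x y) (rlOne pointed))
    (rlInf pointed (rlImp pointed y x) (rlOne pointed)) = rlOne pointed

theorem IsTotallyOrdered.prelinear {A : Type w} [(rlLanguage pointed).Structure A]
    (h : IsCommResiduatedLattice pointed A) (htot : IsTotallyOrdered pointed A) :
    Prelinear pointed A := by
  let := h.toCommResLattice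
  intro x y
  change imp x y ⊓ 1 ⊔ imp y x ⊓ 1 = 1
  rcases htot x y with hxy | hxy
  · rw [inf_eq_right.2 (one_le_imp.2 ((h.rlLe_iff x y).1 hxy))]
    exact sup_eq_left.2 inf_le_right
  · rw [inf_eq_right.2 (one_le_imp.2 ((h.rlLe_iff y x).1 hxy))]
    exact sup_eq_right.2 inf_le_right

/-- Finitely subdirectly irreducible prelinear commutative residuated lattices are totally
ordered. -/
theorem IsFSI.isTotallyOrdered {A : Type w} [(rlLanguage pointed).Structure A]
    (h : IsCommResiduatedLattice pointed A) (hpre : Prelinear pointed A)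
    (hA : IsFSI (rlLanguage pointed) A) : IsTotallyOrdered pointed A := by
  let := h.toCommResLattice
  intro x y
  have hab : imp x y ⊓ 1 ⊔ imp y x ⊓ 1 = 1 := hpre x y
  have hcong : ∀ a : A, a ≤ 1 →
      IsCongruence (L := rlLanguage pointed) (submonoidSetoid (Submonoid.powers a)) := by
    intro a ha
    refine (h.isCongruence_iff _).2 (submonoidSetoid_isCong ?_)
    rintro _ ⟨n, rfl⟩
    exact pow_le_one' ha n
  have htriv : ∀ a : A, a ≤ 1 → submonoidSetoid (Submonoid.powers a) = ⊥ → a = 1 := by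
    intro a ha e
    have : submonoidSetoid (Submonoid.powers a) a 1 :=
      ⟨a, Submonoid.mem_powers a, by simpa using mul_le_one' ha ha, by simp⟩
    rwa [e] at this
  -- By prelinearity the congruences generated by (x → y) ∧ 1 and (y → x) ∧ 1 meet trivially, so one
  -- is trivial and its generator equals 1.
  have hle : ∀ {x y : A}, imp x y ⊓ 1 = 1 → x ≤ y := fun e => one_le_imp.1 (inf_eq_right.1 e)
  have hmem := hA {submonoidSetoid (Submonoid.powers (imp x y ⊓ 1)),
      submonoidSetoid (Submonoid.powers (imp y x ⊓ 1))} (Set.toFinite _) (Set.insert_nonempty _ _)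
    (by
      rintro θ (rfl | rfl)
      · exact hcong _ inf_le_right
      · exact hcong _ inf_le_right)
    (le_bot_iff.1 fun u v huv => submonoidSetoid_powers_inf inf_le_right inf_le_right hab
      (huv _ (.inl rfl)) (huv _ (.inr rfl)))
  rcases hmem with e | e
  · exact .inl ((h.rlLe_iff x y).2 (hle (htriv _ inf_le_right e.symm)))
  · exact .inr ((h.rlLe_iff y x).2 (hle (htriv _ inf_le_right e.symm)))

theorem exists_identity_prelinear (pointed : Bool) :
    ∃ e : (rlLanguage pointed).Term ℕ × (rlLanguage pointed).Term ℕ,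
      ∀ (A : Type w) [(rlLanguage pointed).Structure A],
        Satisfies A e ↔ Prelinear pointed A := by
  let bin (f : RLSymbol pointed 2) (s t : (rlLanguage pointed).Term ℕ) :
    (rlLanguage pointed).Term ℕ := Term.func (L := rlLanguage pointed) f ![s, t]
  let one : (rlLanguage pointed).Term ℕ :=
    Term.func (L := rlLanguage pointed) (RLSymbol.one : RLSymbol pointed 0) ![]
  refine ⟨(bin .sup (bin .inf (bin .imp (.var 0) (.var 1)) one)
    (bin .inf (bin .imp (.var 1) (.var 0)) one), one), fun A _ => ?_⟩
  have hbin : ∀ f s t (x : ℕ → A), (bin f s t).realize x =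
      Structure.funMap (L := rlLanguage pointed) f ![s.realize x, t.realize x] := by
    intro f s t x
    refine congrArg (Structure.funMap (L := rlLanguage pointed) f) (funext fun i => ?_)
    fin_cases i <;> rfl
  have hone : ∀ x : ℕ → A, one.realize x = rlOne pointed := fun x =>
    congrArg (Structure.funMap (L := rlLanguage pointed) (RLSymbol.one : RLSymbol pointed 0))
      (Subsingleton.elim _ _)
  simp only [Satisfies, hbin, hone]
  exact ⟨fun h x y => h fun n => if n = 0 then x else y, fun h x => h (x 0) (x 1)⟩

/-- Prelinearity is an identity that holds in chains, so the variety it defines contains the one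
generated by chains. -/
theorem IsSemilinearCRLVariety.prelinear
    {V : Set (Bundled.{w} (rlLanguage pointed).Structure)} (hV : IsSemilinearCRLVariety pointed V)
    {A : Bundled.{w} (rlLanguage pointed).Structure} (hA : A ∈ V) : Prelinear pointed A := by
  obtain ⟨e, he⟩ := exists_identity_prelinear.{w} pointed
  rw [hV.semilinear] at hA
  have := hA {B | Nonempty B ∧ ∀ e' ∈ ({e} : Set _), Satisfies B e'} ⟨⟨{e}, rfl⟩, ?_⟩
  · exact (he A).1 (this.2 e rfl)
  · rintro B ⟨hB, htot⟩
    refine ⟨hV.isVariety.nonempty_of_mem hB, ?_⟩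
    rintro _ rfl
    exact (he B).2 (htot.prelinear (hV.isCommResiduatedLattice B hB))

/-- The finitely subdirectly irreducible members of a semilinear variety are closed under
subalgebras. -/
theorem IsSemilinearCRLVariety.fsi_of_embedding
    {V : Set (Bundled.{w} (rlLanguage pointed).Structure)} (hV : IsSemilinearCRLVariety pointed V)
    (A B : Bundled.{w} (rlLanguage pointed).Structure) (hA : Nonempty A) (hB : B ∈ fsi V)
    (i : A ↪[rlLanguage pointed] B) : A ∈ fsi V := by
  have hAV := hV.isVariety.mem_of_embedding hB.1 i
  have htot := hB.2.isTotallyOrdered (hV.isCommResiduatedLattice B hB.1) (hV.prelinear hB.1)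
  have hle : ∀ x y : A, rlLe pointed (i x) (i y) → rlLe pointed x y := fun x y h =>
    i.injective ((map_binary i.toHom .inf x y).trans h)
  exact ⟨hAV, IsTotallyOrdered.isFSI (hV.isCommResiduatedLattice A hAV) fun x y =>
    (htot (i x) (i y)).imp (hle x y) (hle y x)⟩

end Transfer

end UA

theorem proposition3p4 :
    (∀ (L : FirstOrder.Language.{u, v}) [L.IsAlgebraic] (V : Set (Bundled.{w} L.Structure)),
      UA.IsVariety V → UA.CongruenceExtensionProperty V →
      UA.homImages (UA.subalgebras (UA.fsi V)) = UA.fsi V →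
      (Amalgamation V ↔ UA.EssentialAmalgamation (UA.fsi V))) ∧
    (∀ (pointed : Bool) (V : Set (Bundled.{w} (UA.rlLanguage pointed).Structure)),
      UA.IsSemilinearCRLVariety pointed V →
      (Amalgamation V ↔ UA.EssentialAmalgamation (UA.fsi V))) := by
  refine ⟨fun L _ V hV hcep hHS => hV.amalgamation_iff hcep fun A B hA hB i => ?_,
    fun pointed V hV => hV.isVariety.amalgamation_iff
      (hV.isVariety.congruenceExtensionProperty_of_isCommResiduatedLattice
        hV.isCommResiduatedLattice) hV.fsi_of_embedding⟩
  -- Closure under subalgebras suffices: A is the image of itself under the identity.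
  rw [← hHS]
  exact ⟨A, ⟨hA, B, hB, ⟨i⟩⟩, Hom.id L A, Function.surjective_id⟩
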